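/- Corollary 1.2 (Adaricheva–Bolat). Let $U_0$ and $U_1$ be subsets of the Euclidean plane $\mathbb{R}^2$, each of which is a circle $\{X : |X-C| = r\}$ or a closed disk $\{X : |X-C| \le r\}$ with some center $C\in\mathbb{R}^2$ and some radius $r\ge 0$ (a single point counts as a degenerate circle and disk). Let $A_0,A_1,A_2\in\mathbb{R}^2$ be arbitrary points (they may be collinear or coincide), and let $\operatorname{conv}$ denote the convex hull. If $$U_0\cup U_1\subseteq \operatorname{conv}(\{A_0,A_1,A_2\}),$$ then there exist $j\in\{0,1,2\}$ and $k\in\{0,1\}$ such that $$U_{1-k}\subseteq \operatorname{conv}\bigl(U_k\cup(\{A_0,A_1,A_2\}\setminus\{A_j\})\bigr).$$ -/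

import Mathlib

/-- A circle in the plane: the points at distance `r` from a center `c`, where `0 ≤ r`
(for `r = 0` it is a single point). `EuclideanSpace ℝ (Fin 2)` carries the Euclidean distance. -/
def IsCircle (U : Set (EuclideanSpace ℝ (Fin 2))) : Prop :=
  ∃ (c : EuclideanSpace ℝ (Fin 2)) (r : ℝ), 0 ≤ r ∧ U = Metric.sphere c r

/-- A (closed) disk in the plane: the points at distance at most `r` from a center `c`,
where `0 ≤ r` (for `r = 0` it is a single point). -/
def IsDisk (U : Set (EuclideanSpace ℝ (Fin 2))) : Prop :=
  ∃ (c : EuclideanSpace ℝ (Fin 2)) (r : ℝ), 0 ≤ r ∧ U = Metric.closedBall c r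

/-! A circle and its disk have the same convex hull, so disks suffice. If the larger radius is
positive, the triangle is nondegenerate. With `r = l * s`, `l ≤ 1`, matching points `p = c + r • u`
and `q = d + s • u` have barycentric coordinates related by `p_i = l * q_i + b_i`, where `b` does
not depend on `u` and sums to `1 - l`. The signs of `b` decide which disk is covered and which
vertex is dropped. In each case `Convex.mem_of_weights_le` concludes: subtracting `t` times a point
of the covering disk leaves nonnegative weights, with weight zero at the dropped vertex. -/

open Metric

/-- If the weights of `x` dominate `t` times those of a point `y` of a convex set, with equality at
the index `j`, and all the vertices except `A j` lie in the set, then so does `x`. -/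
theorem Convex.mem_of_weights_le {ι E : Type*} [Fintype ι] [AddCommGroup E] [Module ℝ E]
    {S : Set E} (hS : Convex ℝ S) {A : ι → E} {j : ι} (hA : ∀ i, i ≠ j → A i ∈ S)
    {x y : E} (hy : y ∈ S) {u v : ι → ℝ} (hu : ∑ i, u i = 1) (hv : ∑ i, v i = 1)
    (hux : ∑ i, u i • A i = x) (hvy : ∑ i, v i • A i = y)
    {t : ℝ} (ht : 0 ≤ t) (hj : u j = t * v j) (hle : ∀ i, t * v i ≤ u i) : x ∈ S := by
  classical
  let w : Option ι → ℝ := fun o => o.elim t fun i => u i - t * v i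
  -- The weight at `j` is zero, so `A j`, which may lie outside `S`, can be replaced by `y`.
  let Z : Option ι → E := fun o => o.elim y fun i => if i = j then y else A i
  have key : ∑ o, w o • Z o = x := by
    have h : ∀ i, w (some i) • Z (some i) = u i • A i - t • (v i • A i) := by
      intro i
      by_cases hi : i = j
      · subst hi
        simp [w, hj, mul_smul]
      · simp [w, Z, hi, sub_smul, mul_smul]
    rw [Fintype.sum_option, Finset.sum_congr rfl fun i _ => h i, Finset.sum_sub_distrib,
      ← Finset.smul_sum, hux, hvy]
    simp [w, Z]
  rw [← key]
  refine hS.sum_mem ?_ ?_ ?_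
  · rintro (_ | i) -
    · exact ht
    · simpa [w] using hle i
  · rw [Fintype.sum_option]
    simp [w, Finset.sum_sub_distrib, ← Finset.mul_sum, hu, hv]
  · rintro (_ | i) -
    · exact hy
    · by_cases hi : i = j
      · simpa [Z, hi] using hy
      · simpa [Z, hi] using hA i hi

/-- The largest multiple of a probability vector that is dominated by a nonnegative vector meets
it in some coordinate. -/
theorem exists_eq_mul_and_mul_le {ι : Type*} [Fintype ι] {u v : ι → ℝ} (hu : ∀ i, 0 ≤ u i)
    (hv : ∀ i, 0 ≤ v i) (hv1 : ∑ i, v i = 1) :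
    ∃ (j : ι) (t : ℝ), 0 ≤ t ∧ u j = t * v j ∧ ∀ i, t * v i ≤ u i := by
  classical
  have hne : (Finset.univ.filter fun i => 0 < v i).Nonempty := by
    by_contra h
    rw [Finset.not_nonempty_iff_eq_empty, Finset.filter_eq_empty_iff] at h
    have : ∑ i, v i ≤ 0 := Finset.sum_nonpos fun i hi => not_lt.1 (h hi)
    linarith
  -- Indices with `v i = 0` put no bound on the multiple.
  obtain ⟨j, hj, hmin⟩ := Finset.exists_min_image _ (fun i => u i / v i) hne
  have hj' : 0 < v j := (Finset.mem_filter.1 hj).2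
  refine ⟨j, u j / v j, div_nonneg (hu j) hj'.le, (div_mul_cancel₀ _ hj'.ne').symm, fun i => ?_⟩
  rcases (hv i).eq_or_lt with h | h
  · simpa [← h] using hu i
  · exact (le_div_iff₀ h).1 (hmin i (by simpa using h))

/-- Given two points `x`, `y` in the convex hull of a finite set, some vertex can be replaced by `y`
with `x` still in the convex hull. -/
theorem exists_mem_convexHull_insert_diff_singleton {E : Type*} [AddCommGroup E] [Module ℝ E]
    {s : Finset E} {x y : E} (hx : x ∈ convexHull ℝ (s : Set E))
    (hy : y ∈ convexHull ℝ (s : Set E)) :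
    ∃ a ∈ s, x ∈ convexHull ℝ ({y} ∪ ((s : Set E) \ {a})) := by
  obtain ⟨u, hu, hu1, hux⟩ := Finset.mem_convexHull'.1 hx
  obtain ⟨v, hv, hv1, hvy⟩ := Finset.mem_convexHull'.1 hy
  rw [← Finset.sum_coe_sort] at hu1 hux hv1 hvy
  obtain ⟨j, t, ht, hj, hle⟩ := exists_eq_mul_and_mul_le (u := fun i : s => u i)
    (v := fun i : s => v i) (fun i => hu i i.2) (fun i => hv i i.2) hv1
  refine ⟨j, j.2, (convex_convexHull ℝ _).mem_of_weights_le (A := fun i : s => (i : E)) (j := j)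
    (fun i hi => ?_) (subset_convexHull ℝ _ (by simp)) hu1 hv1 hux hvy ht hj hle⟩
  exact subset_convexHull ℝ _ (Or.inr ⟨i.2, fun h => hi (Subtype.ext h)⟩)

/-- A point of the closed ball with center `c` and radius `r` is `c + r • u` with `‖u‖ ≤ 1`. -/
theorem exists_eq_add_smul_of_mem_closedBall {E : Type*} [NormedAddCommGroup E] [NormedSpace ℝ E]
    {c p : E} {r : ℝ} (hr : 0 ≤ r) (hp : p ∈ closedBall c r) :
    ∃ u : E, ‖u‖ ≤ 1 ∧ p = c + r • u := by
  rw [mem_closedBall, dist_eq_norm] at hp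
  rcases hr.eq_or_lt with rfl | hr
  · exact ⟨0, by simp, by simpa [sub_eq_zero] using hp⟩
  · refine ⟨r⁻¹ • (p - c), ?_, ?_⟩
    · rw [norm_smul, norm_inv, Real.norm_of_nonneg hr.le, inv_mul_le_iff₀ hr]
      simpa using hp
    · rw [smul_inv_smul₀ hr.ne']
      abel

theorem add_smul_mem_closedBall {E : Type*} [NormedAddCommGroup E] [NormedSpace ℝ E]
    {c u : E} {r : ℝ} (hr : 0 ≤ r) (hu : ‖u‖ ≤ 1) : c + r • u ∈ closedBall c r := by
  rw [mem_closedBall, dist_eq_norm, add_sub_cancel_left, norm_smul, Real.norm_of_nonneg hr]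
  exact mul_le_of_le_one_right hr hu

/-- Three reals are all nonnegative, or one is nonpositive and the others are
nonnegative, or two are nonpositive. -/
theorem sign_trichotomy_fin_three (b : Fin 3 → ℝ) :
    (∀ i, 0 ≤ b i) ∨ (∃ j, b j ≤ 0 ∧ ∀ i, i ≠ j → 0 ≤ b i) ∨ ∃ j, ∀ i, i ≠ j → b i ≤ 0 := by
  simp only [Fin.forall_fin_succ, Fin.exists_fin_succ]
  rcases le_total (b 0) 0 with h0 | h0 <;> rcases le_total (b 1) 0 with h1 | h1 <;>
    rcases le_total (b 2) 0 with h2 | h2 <;> simp_all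

/-- Of two disks in a nondegenerate triangle, one lies in the convex hull of the other one together
with two vertices of the triangle. -/
theorem AffineBasis.exists_closedBall_subset_convexHull {E : Type*} [NormedAddCommGroup E]
    [NormedSpace ℝ E] (A : AffineBasis (Fin 3) ℝ E) {c d : E} {r s : ℝ} (hr : 0 ≤ r)
    (hrs : r ≤ s) (hs : 0 < s) (hc : closedBall c r ⊆ convexHull ℝ (Set.range A))
    (hd : closedBall d s ⊆ convexHull ℝ (Set.range A)) :
    ∃ j : Fin 3,
      closedBall c r ⊆ convexHull ℝ (closedBall d s ∪ (Set.range A \ {A j})) ∨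
      closedBall d s ⊆ convexHull ℝ (closedBall c r ∪ (Set.range A \ {A j})) := by
  have hA : ∀ (S : Set E) (j i : Fin 3), i ≠ j →
      A i ∈ convexHull ℝ (S ∪ (Set.range A \ {A j})) := fun S j i hij =>
    subset_convexHull ℝ _ (Or.inr ⟨⟨i, rfl⟩, fun h => hij (A.ind.injective h)⟩)
  have hball : ∀ (S : Set E) (j : Fin 3) {p}, p ∈ S →
      p ∈ convexHull ℝ (S ∪ (Set.range A \ {A j})) := fun S j p hp =>
    subset_convexHull ℝ _ (Or.inl hp)
  rw [A.convexHull_eq_nonneg_coord] at hc hd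
  obtain ⟨l, hl0, hl1, rfl⟩ : ∃ l : ℝ, 0 ≤ l ∧ l ≤ 1 ∧ r = l * s :=
    ⟨r / s, by positivity, (div_le_one hs).2 hrs, by field_simp⟩
  set b : Fin 3 → ℝ := fun i => A.coord i c - l * A.coord i d with hb
  have hb1 : ∑ i, b i = 1 - l := by
    simp [hb, Finset.sum_sub_distrib, ← Finset.mul_sum]
  have hcoord : ∀ i u, A.coord i (c + (l * s) • u) = l * A.coord i (d + s • u) + b i := by
    intro i u
    have h : ∀ x v : E, A.coord i (x + v) = A.coord i x + (A.coord i).linear v := by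
      intro x v
      rw [add_comm x v, ← vadd_eq_add, AffineMap.map_vadd, vadd_eq_add, add_comm]
    rw [h, h, map_smul, map_smul]
    simp only [hb, smul_eq_mul]
    ring
  have hsum : ∀ p, ∑ i, A.coord i p = 1 := A.sum_coord_apply_eq_one
  have hlin : ∀ p, ∑ i, A.coord i p • A i = p := A.linear_combination_coord_eq_self
  have hd' : ∀ {p}, p ∈ closedBall d s → ∀ i, 0 ≤ A.coord i p := fun hp => hd hp
  have hc' : ∀ {p}, p ∈ closedBall c (l * s) → ∀ i, 0 ≤ A.coord i p := fun hp => hc hp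
  have hdd : d ∈ closedBall d s := mem_closedBall_self hs.le
  rcases sign_trichotomy_fin_three b with h | ⟨j, hj, h⟩ | ⟨j, h⟩
  -- Comparing `b` with the center `d`, rather than with `q`, gives one `j` for all points `p`.
  · obtain ⟨j, t, ht, hj, hle⟩ := exists_eq_mul_and_mul_le h (hd' hdd) (hsum d)
    refine ⟨j, Or.inl fun p hp => ?_⟩
    obtain ⟨u, hu, rfl⟩ := exists_eq_add_smul_of_mem_closedBall hr hp
    have hq : d + s • u ∈ closedBall d s := add_smul_mem_closedBall hs.le hu
    -- `y` is the mean of `q` and `d` with weights `l` and `t`; any point serves if both vanish.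
    obtain ⟨y, hy, hyc⟩ : ∃ y ∈ closedBall d s, ∀ i,
        (l + t) * A.coord i y = l * A.coord i (d + s • u) + t * A.coord i d := by
      rcases (add_nonneg hl0 ht).eq_or_lt with h0 | h0
      · exact ⟨d, hdd, fun i => by
          rw [show l = 0 by linarith, show t = 0 by linarith]
          ring⟩
      · refine ⟨AffineMap.lineMap (d + s • u) d (t / (l + t)),
          (convex_closedBall d s).lineMap_mem hq hdd
            ⟨by positivity, (div_le_one h0).2 (by linarith)⟩, fun i => ?_⟩
        rw [AffineMap.apply_lineMap, AffineMap.lineMap_apply_module, smul_eq_mul, smul_eq_mul]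
        field_simp
        ring
    refine (convex_convexHull ℝ _).mem_of_weights_le (hA _ j) (hball _ j hy) (hsum _) (hsum _)
      (hlin _) (hlin _) (add_nonneg hl0 ht) ?_ fun i => ?_
    · rw [hyc, hcoord, hj]
    · rw [hyc, hcoord]
      linarith [hle i]
  · refine ⟨j, Or.inl fun p hp => ?_⟩
    obtain ⟨u, hu, rfl⟩ := exists_eq_add_smul_of_mem_closedBall hr hp
    have hq : d + s • u ∈ closedBall d s := add_smul_mem_closedBall hs.le hu
    have hpj := hc' hp j
    have hqj := hd' hq j
    have hpq := hcoord j u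
    -- As `b j ≤ 0`, the ratio `p_j / q_j` is at most `l`, and `q_j = 0` forces `p_j = 0`.
    obtain ⟨t, ht, htl, htj⟩ : ∃ t : ℝ, 0 ≤ t ∧ t ≤ l ∧
        A.coord j (c + (l * s) • u) = t * A.coord j (d + s • u) := by
      rcases hqj.eq_or_lt with h0 | h0
      · refine ⟨0, le_rfl, hl0, ?_⟩
        rw [← h0] at hpq
        linarith
      · exact ⟨_ / _, div_nonneg hpj hqj, (div_le_iff₀ h0).2 (by linarith),
          (div_mul_cancel₀ _ h0.ne').symm⟩
    refine (convex_convexHull ℝ _).mem_of_weights_le (hA _ j) (hball _ j hq) (hsum _) (hsum _)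
      (hlin _) (hlin _) ht htj fun i => ?_
    rcases eq_or_ne i j with rfl | hij
    · exact htj.ge
    · rw [hcoord]
      linarith [h i hij, mul_le_mul_of_nonneg_right htl (hd' hq i)]
  · refine ⟨j, Or.inr fun q hq => ?_⟩
    obtain ⟨u, hu, rfl⟩ := exists_eq_add_smul_of_mem_closedBall hs.le hq
    have hp : c + (l * s) • u ∈ closedBall c (l * s) := add_smul_mem_closedBall hr hu
    have hbj : 1 - l ≤ b j := by
      rw [← hb1, ← Finset.add_sum_erase _ _ (Finset.mem_univ j)]
      have : ∑ i ∈ Finset.univ.erase j, b i ≤ 0 :=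
        Finset.sum_nonpos fun i hi => h i (Finset.ne_of_mem_erase hi)
      linarith
    have hpj := hc' hp j
    have hqj := hd' hq j
    have hqj1 : A.coord j (d + s • u) ≤ 1 := by
      rw [← hsum (d + s • u)]
      exact Finset.single_le_sum (fun i _ => hd' hq i) (Finset.mem_univ j)
    -- `p_j - q_j ≥ (1 - l) * (1 - q_j) ≥ 0`.
    have hqp : A.coord j (d + s • u) ≤ A.coord j (c + (l * s) • u) := by
      rw [hcoord]
      nlinarith
    obtain ⟨t, ht, ht1, htj⟩ : ∃ t : ℝ, 0 ≤ t ∧ t ≤ 1 ∧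
        A.coord j (d + s • u) = t * A.coord j (c + (l * s) • u) := by
      rcases hpj.eq_or_lt with h0 | h0
      · exact ⟨0, le_rfl, zero_le_one, by linarith⟩
      · exact ⟨_ / _, div_nonneg hqj hpj, (div_le_one h0).2 hqp,
          (div_mul_cancel₀ _ h0.ne').symm⟩
    refine (convex_convexHull ℝ _).mem_of_weights_le (hA _ j) (hball _ j hp) (hsum _) (hsum _)
      (hlin _) (hlin _) ht htj fun i => ?_
    rcases eq_or_ne i j with rfl | hij
    · exact htj.ge
    · have h1 := mul_le_of_le_one_left (hc' hp i) ht1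
      have h2 := mul_le_of_le_one_left (hd' hq i) hl1
      linarith [h i hij, hcoord i u]

/-- Of two disks in a possibly degenerate triangle, one lies in the convex hull of the other one
together with two vertices of the triangle. -/
theorem exists_closedBall_subset_convexHull_union_diff (A : Fin 3 → EuclideanSpace ℝ (Fin 2))
    {c d : EuclideanSpace ℝ (Fin 2)} {r s : ℝ} (hr : 0 ≤ r) (hrs : r ≤ s)
    (hc : closedBall c r ⊆ convexHull ℝ (Set.range A))
    (hd : closedBall d s ⊆ convexHull ℝ (Set.range A)) :
    ∃ j : Fin 3,
      closedBall c r ⊆ convexHull ℝ (closedBall d s ∪ (Set.range A \ {A j})) ∨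
      closedBall d s ⊆ convexHull ℝ (closedBall c r ∪ (Set.range A \ {A j})) := by
  -- If `s = 0`, both disks are points and the triangle may be degenerate; otherwise it has interior
  -- points.
  rcases (hr.trans hrs).eq_or_lt with rfl | hs
  · obtain rfl := le_antisymm hrs hr
    classical
    have hA : Set.range A = ((Finset.univ.image A : Finset _) : Set _) := by simp
    simp only [closedBall_zero, Set.singleton_subset_iff] at hc hd ⊢
    rw [hA] at hc hd ⊢
    obtain ⟨a, ha, h⟩ := exists_mem_convexHull_insert_diff_singleton hc hd
    obtain ⟨j, -, rfl⟩ := Finset.mem_image.1 ha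
    exact ⟨j, Or.inl h⟩
  · have htop : affineSpan ℝ (Set.range A) = ⊤ := by
      rw [← interior_convexHull_nonempty_iff_affineSpan_eq_top]
      exact ⟨d, interior_mono hd (ball_subset_interior_closedBall (mem_ball_self hs))⟩
    have hind : AffineIndependent ℝ A := by
      rw [affineIndependent_iff_finrank_vectorSpan_eq ℝ A (n := 2) (by simp),
        ← direction_affineSpan, htop, AffineSubspace.direction_top, finrank_top]
      simp
    exact AffineBasis.exists_closedBall_subset_convexHull ⟨A, hind, htop⟩ hr hrs hs hc hd

/-- The convex hull of a circle or a disk is a disk. -/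
theorem exists_convexHull_eq_closedBall {U : Set (EuclideanSpace ℝ (Fin 2))}
    (hU : IsCircle U ∨ IsDisk U) :
    ∃ (c : EuclideanSpace ℝ (Fin 2)) (r : ℝ), 0 ≤ r ∧ convexHull ℝ U = closedBall c r := by
  rcases hU with ⟨c, r, hr, rfl⟩ | ⟨c, r, hr, rfl⟩
  · exact ⟨c, r, hr, convexHull_sphere_eq_closedBall c hr⟩
  · exact ⟨c, r, hr, (convex_closedBall c r).convexHull_eq⟩

theorem corollary1p2 (U : Fin 2 → Set (EuclideanSpace ℝ (Fin 2)))
    (hU : ∀ i, IsCircle (U i) ∨ IsDisk (U i))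
    (A : Fin 3 → EuclideanSpace ℝ (Fin 2))
    (hA : U 0 ∪ U 1 ⊆ convexHull ℝ ({A 0, A 1, A 2} : Set (EuclideanSpace ℝ (Fin 2)))) :
    ∃ (j : Fin 3) (k : Fin 2),
      U (1 - k) ⊆ convexHull ℝ
        (U k ∪ (({A 0, A 1, A 2} : Set (EuclideanSpace ℝ (Fin 2))) \ {A j})) := by
  have hrange : ({A 0, A 1, A 2} : Set (EuclideanSpace ℝ (Fin 2))) = Set.range A := by
    ext x
    simp [Fin.exists_fin_succ, eq_comm]
  rw [hrange] at hA ⊢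
  choose c r hr hcr using fun i => exists_convexHull_eq_closedBall (hU i)
  have hsub : ∀ i, closedBall (c i) (r i) ⊆ convexHull ℝ (Set.range A) := by
    intro i
    rw [← hcr]
    refine convexHull_min ?_ (convex_convexHull ℝ _)
    fin_cases i
    · exact Set.subset_union_left.trans hA
    · exact Set.subset_union_right.trans hA
  have hfin : ∀ {j : Fin 3} {k l : Fin 2},
      closedBall (c l) (r l) ⊆ convexHull ℝ (closedBall (c k) (r k) ∪ (Set.range A \ {A j})) →
      U l ⊆ convexHull ℝ (U k ∪ (Set.range A \ {A j})) := by
    intro j k l h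
    rw [← hcr, ← hcr, convexHull_convexHull_union_left] at h
    exact (subset_convexHull ℝ _).trans h
  rcases le_total (r 0) (r 1) with h | h
  · obtain ⟨j, hj | hj⟩ :=
      exists_closedBall_subset_convexHull_union_diff A (hr 0) h (hsub 0) (hsub 1)
    · exact ⟨j, 1, hfin hj⟩
    · exact ⟨j, 0, hfin hj⟩
  · obtain ⟨j, hj | hj⟩ :=
      exists_closedBall_subset_convexHull_union_diff A (hr 1) h (hsub 1) (hsub 0)
    · exact ⟨j, 0, hfin hj⟩
    · exact ⟨j, 1, hfin hj⟩
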